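/- Let $\mathbb{T}=\mathbb{R}/\mathbb{Z}$, and for $X\subseteq\mathbb{T}$ let $\Delta_{\mathbb{T}}(X)=\inf_{x,x'\in X,\,x\neq x'}\min_{p\in\mathbb{Z}}|x-x'+p|$ be its minimal wrap-around separation. For every real $\delta>2$ there exists $M_\delta\in\mathbb{N}$ such that for every integer $m\ge M_\delta$ there exist a finite set $X_m=\{x_1,\dots,x_s\}\subset\mathbb{T}$ with $\Delta_{\mathbb{T}}(X_m)\ge \frac1m-\frac{\delta}{m^2}$ and nonzero complex numbers $c_1,\dots,c_s$ such that the measure $\mu_m=\sum_{k=1}^s c_k\delta_{x_k}$ is not a solution of the total-variation minimization program $$\min_{\nu}\ |\nu|(\mathbb{T})\quad\text{subject to}\quad \int_{\mathbb{T}}e^{i2\pi k\omega}\,d\nu(\omega)=\int_{\mathbb{T}}e^{i2\pi k\omega}\,d\mu_m(\omega)\ \text{ for all integers } -m\le k\le m,$$ where $\nu$ ranges over all complex Radon measures on $\mathbb{T}$ and $|\nu|(\mathbb{T})$ is the total variation of $\nu$. That is, some complex measure with the same $2m+1$ moments as $\mu_m$ has strictly smaller total variation. -/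

import Mathlib

open MeasureTheory
open scoped ENNReal

noncomputable section

/-- The minimal wrap-around distance `inf_{x ≠ x' ∈ X} min_{p ∈ ℤ} |x - x' + p|` of a subset of
the torus `𝕋 = ℝ / ℤ`. The quotient distance of `UnitAddCircle` is the wrap-around distance; the
infimum is `∞` when `X` has at most one point. -/
def wrapSep (X : Set UnitAddCircle) : ℝ≥0∞ := X.einfsep

/-- The `2m+1` trigonometric moments `y_k = ∫_𝕋 e^{i2πkω} dμ(ω)`, `-m ≤ k ≤ m`, of a complex
measure `μ` on the torus. -/
def trigMoments (m : ℕ) (μ : ComplexMeasure UnitAddCircle) :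
    Finset.Icc (-(m : ℤ)) (m : ℤ) → ℂ :=
  fun k => ∫ᵛ ω, fourier (k : ℤ) ω ∂[ContinuousLinearMap.mul ℝ ℂ; μ]

/-- The total mass `|μ|(𝕋)` of a complex measure on the torus. -/
def totalMass (μ : ComplexMeasure UnitAddCircle) : ℝ≥0∞ := μ.variation Set.univ

/-- `ν` is a solution of the total-variation program with data `y`: it minimizes the total mass
among all complex measures on the torus whose moments are `y`. -/
def IsTVSolution (m : ℕ) (y : Finset.Icc (-(m : ℤ)) (m : ℤ) → ℂ)
    (ν : ComplexMeasure UnitAddCircle) : Prop :=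
  trigMoments m ν = y ∧
    ∀ ν' : ComplexMeasure UnitAddCircle, trigMoments m ν' = y → totalMass ν ≤ totalMass ν'

/-- The discrete measure `∑_{x ∈ X} c_x δ_x`. -/
def discreteMeasure (X : Finset UnitAddCircle) (c : UnitAddCircle → ℂ) :
    ComplexMeasure UnitAddCircle :=
  ∑ x ∈ X, VectorMeasure.dirac x (c x)

end

/-!
Both competing measures live on equally spaced points. Put `n = m + 2`, `x_k = k / n`, and for a
small shift `h` consider
`μ = ∑ₖ sin (2π (x_k - h)) δ_{x_k}` and `ν = ∑ₖ sin (2π x_k) δ_{x_k + h}`.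
Tested against `e^{2πijω}` with `|j| ≤ m`, each is the `n`-point rectangle rule, on the grid and on
the grid shifted by `h` respectively, for one and the same trigonometric polynomial
`sin (2π (ω - h)) e^{2πijω}`. Its degree is at most `m + 1 < n`, so the rule is exact on both grids
and the moments agree (`grid_sum_sine_mul_fourier`).

The total masses are `φ (h)` and `φ (0)`, where `φ (h) = ∑ₖ |sin (2π (x_k - h))|`. The term `k = 0`
gives `φ` a convex kink at `h = 0`, and the other terms fall at most to second order in `h` after
averaging over `± h`, so `φ (0)` is not a maximum: `φ (h) > φ (0)` for `h = 1 / (8n)` or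
`h = -1 / (8n)` (`exists_shift_mass_lt`). Finally `1 / (m + 2) ≥ 1 / m - 2 / m ^ 2`.
-/

open scoped Real

/-! ### The equally spaced grid and its rectangle rule -/

/-- The point `k / n` of the circle `ℝ / ℤ`. -/
noncomputable def gridPoint (n k : ℕ) : UnitAddCircle := ((k / n : ℝ) : UnitAddCircle)

/-- The function `x ↦ sin (2πx)` on the circle `ℝ / ℤ`. -/
noncomputable def circleSine (x : UnitAddCircle) : ℝ := (fourier 1 x : ℂ).im

lemma circleSine_coe (t : ℝ) : circleSine (t : UnitAddCircle) = Real.sin (2 * π * t) := by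
  have h : 2 * (π : ℂ) * Complex.I * ((1 : ℤ) : ℂ) * (t : ℂ) / ((1 : ℝ) : ℂ)
      = ((2 * π * t : ℝ) : ℂ) * Complex.I := by
    push_cast; ring
  rw [circleSine, fourier_coe_apply, h, Complex.exp_ofReal_mul_I_im]

lemma ofReal_circleSine (x : UnitAddCircle) :
    (circleSine x : ℂ) = (fourier 1 x - fourier (-1) x) / (2 * Complex.I) := by
  rw [circleSine, Complex.im_eq_sub_conj, fourier_neg]

lemma gridPoint_injOn {n : ℕ} (hn : n ≠ 0) :
    Set.InjOn (gridPoint n) (Finset.range n : Set ℕ) := by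
  have hn' : (0 : ℝ) < n := by positivity
  intro k hk l hl h
  have mem : ∀ i ∈ (Finset.range n : Set ℕ), (i / n : ℝ) ∈ Set.Ico (0 : ℝ) (0 + 1) := by
    intro i hi
    have : (i : ℝ) < n := by exact_mod_cast Finset.mem_range.1 (Finset.mem_coe.1 hi)
    exact ⟨by positivity, by rw [zero_add, div_lt_one hn']; exact this⟩
  have := (AddCircle.coe_eq_coe_iff_of_mem_Ico (mem k hk) (mem l hl)).1 h
  exact_mod_cast (div_left_inj' hn'.ne').1 this

lemma inv_le_dist_gridPoint {n : ℕ} (hn : n ≠ 0) {k l : ℕ} (h : gridPoint n k ≠ gridPoint n l) :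
    1 / (n : ℝ) ≤ dist (gridPoint n k) (gridPoint n l) := by
  have hn' : (0 : ℝ) < n := by positivity
  have hpos : 0 < dist (gridPoint n k) (gridPoint n l) := dist_pos.2 h
  set r : ℤ := round ((k / n : ℝ) - l / n) with hr
  -- A nonzero distance is `1 / n` times a nonzero integer.
  have key : dist (gridPoint n k) (gridPoint n l) = |(((k : ℤ) - l - n * r : ℤ) : ℝ)| / n := by
    rw [dist_eq_norm, gridPoint, gridPoint, ← AddCircle.coe_sub, UnitAddCircle.norm_eq, ← hr]
    have habs : ∀ a : ℝ, |a| / n = |a / n| := fun a => by rw [abs_div, abs_of_pos hn']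
    rw [habs]
    congr 1
    push_cast
    field_simp
  rw [key] at hpos ⊢
  have hz : (k : ℤ) - l - n * r ≠ 0 := by
    intro h0
    rw [h0] at hpos
    simp at hpos
  gcongr
  exact_mod_cast Int.one_le_abs hz

lemma sum_fourier_gridPoint_eq_zero {n : ℕ} {l : ℤ} (hl : l ≠ 0) (hln : |l| < n) :
    ∑ k ∈ Finset.range n, (fourier l (gridPoint n k) : ℂ) = 0 := by
  have hn : (n : ℂ) ≠ 0 := by
    have : (0 : ℤ) < n := (abs_nonneg l).trans_lt hln
    exact_mod_cast this.ne'
  set ζ : ℂ := Complex.exp (2 * π * Complex.I * l / n) with hζ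
  have hterm : ∀ k : ℕ, (fourier l (gridPoint n k) : ℂ) = ζ ^ k := by
    intro k
    rw [gridPoint, fourier_coe_apply, hζ, ← Complex.exp_nat_mul]
    congr 1
    push_cast
    ring
  have hζn : ζ ^ n = 1 := by
    rw [hζ, ← Complex.exp_nat_mul, Complex.exp_eq_one_iff]
    exact ⟨l, by field_simp⟩
  have hζ1 : ζ ≠ 1 := by
    rw [hζ, Ne, Complex.exp_eq_one_iff]
    rintro ⟨z, hz⟩
    have h2 : (2 * π * Complex.I : ℂ) ≠ 0 := Complex.two_pi_I_ne_zero
    have h3 : (l : ℂ) = n * z := by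
      field_simp at hz
      linear_combination hz
    have h4 : l = n * z := by exact_mod_cast h3
    exact hl (Int.eq_zero_of_abs_lt_dvd ⟨z, h4⟩ hln)
  simp_rw [hterm]
  rw [geom_sum_eq hζ1, hζn, sub_self, zero_div]

/-- For `|j| ≤ n - 2` the `n`-point rectangle rule gives the same value for the trigonometric
polynomial `sin (2π (ω - h)) e^{2πijω}` on the grid and on the grid shifted by `h`. -/
lemma grid_sum_sine_mul_fourier {n : ℕ} {j : ℤ} (hj : |j| + 1 < n) (h : UnitAddCircle) :
    ∑ k ∈ Finset.range n, (fourier j (gridPoint n k) : ℂ) * circleSine (gridPoint n k - h) =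
      ∑ k ∈ Finset.range n, (fourier j (gridPoint n k + h) : ℂ) * circleSine (gridPoint n k) := by
  have hadd : ∀ (l : ℤ) (x y : UnitAddCircle),
      (fourier l (x + y) : ℂ) = fourier l x * fourier l y := by
    intro l x y
    simp only [fourier_apply, smul_add, AddCircle.toCircle_add, Circle.coe_mul]
  have hneg : ∀ (l : ℤ) (x : UnitAddCircle), (fourier l (-x) : ℂ) = fourier (-l) x := by
    intro l x
    simp only [fourier_apply, smul_neg, neg_smul]
  -- Either the frequency `l` sums to zero over the grid, or `l = 0` and the coefficients agree.
  have hmode : ∀ (l : ℤ) (a b : ℂ), |l| < n → (l = 0 → a = b) →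
      a * ∑ k ∈ Finset.range n, (fourier l (gridPoint n k) : ℂ) =
        b * ∑ k ∈ Finset.range n, (fourier l (gridPoint n k) : ℂ) := by
    intro l a b hl hab
    by_cases h0 : l = 0
    · rw [hab h0]
    · rw [sum_fourier_gridPoint_eq_zero h0 hl, mul_zero, mul_zero]
  have h1 := hmode (j + 1) (fourier (-1) h) (fourier j h) (by grind)
    (fun h0 => by rw [show j = -1 by omega])
  have h2 := hmode (j + -1) (fourier 1 h) (fourier j h) (by grind)
    (fun h0 => by rw [show j = 1 by omega])
  have hL : ∀ x : UnitAddCircle, (fourier j x : ℂ) * circleSine (x - h) =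
      (fourier (-1) h * fourier (j + 1) x - fourier 1 h * fourier (j + -1) x)
        / (2 * Complex.I) := by
    intro x
    rw [ofReal_circleSine, sub_eq_add_neg x h, hadd, hadd, hneg, hneg, neg_neg, fourier_add,
      fourier_add]
    ring
  have hR : ∀ x : UnitAddCircle, (fourier j (x + h) : ℂ) * circleSine x =
      (fourier j h * fourier (j + 1) x - fourier j h * fourier (j + -1) x)
        / (2 * Complex.I) := by
    intro x
    rw [ofReal_circleSine, hadd, fourier_add, fourier_add]
    ring
  simp_rw [hL, hR]
  rw [← Finset.sum_div, ← Finset.sum_div, Finset.sum_sub_distrib, Finset.sum_sub_distrib,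
    ← Finset.mul_sum, ← Finset.mul_sum, ← Finset.mul_sum, ← Finset.mul_sum, h1, h2]

/-! ### The gain in mass -/

/-- A small shift of the grid, forwards or backwards, increases the sum of `|sin|` over it: the
summand at the origin gains to first order, while the others, averaged over the two directions, lose
at most to second order. -/
lemma exists_shift_mass_lt {n : ℕ} (hn : n ≠ 0) :
    ∃ h : UnitAddCircle, (∀ k, circleSine (gridPoint n k - h) ≠ 0) ∧
      ∑ k ∈ Finset.range n, |circleSine (gridPoint n k)| <
        ∑ k ∈ Finset.range n, |circleSine (gridPoint n k - h)| := by
  have hn' : (0 : ℝ) < n := by positivity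
  have hn1 : (1 : ℝ) ≤ n := by exact_mod_cast Nat.one_le_iff_ne_zero.2 hn
  have hπ := Real.pi_pos
  have hshift : ∀ (k : ℕ) (t : ℝ), circleSine (gridPoint n k - (t : UnitAddCircle)) =
      Real.sin (2 * π * (k / n - t)) := by
    intro k t
    rw [gridPoint, ← AddCircle.coe_sub, circleSine_coe]
  -- `2 (k / n - t)` is an odd multiple of `1 / (4 n)`, hence not an integer.
  have hne : ∀ (ε : ℤ) (k : ℕ), (ε = 1 ∨ ε = -1) →
      circleSine (gridPoint n k - ((ε / (8 * n) : ℝ) : UnitAddCircle)) ≠ 0 := by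
    intro ε k hε
    rw [hshift, Ne, Real.sin_eq_zero_iff]
    rintro ⟨z, hz⟩
    have h1 : ((4 * (n * z) : ℤ) : ℝ) = ((8 * k - ε : ℤ) : ℝ) := by
      have h2 : (z : ℝ) = 2 * (k / n - ε / (8 * n)) := by
        apply mul_right_cancel₀ hπ.ne'
        rw [hz]; ring
      push_cast
      rw [h2]
      field_simp
      ring
    have h3 : 4 * ((n : ℤ) * z) = 8 * k - ε := by exact_mod_cast h1
    generalize (n : ℤ) * z = t at h3
    omega
  set v : ℝ := π / (4 * n) with hv
  have hv0 : 0 < v := by positivity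
  have hvn : v * n = π / 4 := by rw [hv]; field_simp
  have hv1 : v ≤ π / 4 := by nlinarith
  have hcos : 0 ≤ Real.cos v :=
    Real.cos_nonneg_of_neg_pi_div_two_le_of_le (by linarith) (by linarith)
  set u : ℕ → ℝ := fun k => 2 * π * (k / n) with hu
  set φ : ℝ := ∑ k ∈ Finset.range n, |Real.sin (u k)| with hφ
  have hφn : φ ≤ n := by
    calc φ ≤ ∑ k ∈ Finset.range n, (1 : ℝ) := Finset.sum_le_sum fun k _ => Real.abs_sin_le_one _
      _ = n := by simp
  have hφ0 : 0 ≤ φ := Finset.sum_nonneg fun k _ => abs_nonneg _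
  have hpt : ∀ k, 2 * Real.cos v * |Real.sin (u k)| + (if k = 0 then 2 * Real.sin v else 0) ≤
      |Real.sin (u k - v)| + |Real.sin (u k + v)| := by
    intro k
    split_ifs with hk
    · have : u k = 0 := by simp [hu, hk]
      have hs := le_abs_self (Real.sin v)
      simp only [this, Real.sin_zero, abs_zero, zero_sub, zero_add, Real.sin_neg, abs_neg]
      linarith
    · have : Real.sin (u k - v) + Real.sin (u k + v) = 2 * Real.cos v * Real.sin (u k) := by
        rw [Real.sin_sub, Real.sin_add]; ring
      have h2 : |Real.sin (u k - v) + Real.sin (u k + v)| = 2 * Real.cos v * |Real.sin (u k)| := by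
        rw [this, abs_mul, abs_of_nonneg (by positivity)]
      rw [add_zero, ← h2]
      exact abs_add_le _ _
  have hsum : 2 * Real.cos v * φ + 2 * Real.sin v ≤
      ∑ k ∈ Finset.range n, |Real.sin (u k - v)| + ∑ k ∈ Finset.range n, |Real.sin (u k + v)| := by
    have := Finset.sum_le_sum fun k (_ : k ∈ Finset.range n) => hpt k
    rw [Finset.sum_add_distrib, Finset.sum_add_distrib, ← Finset.mul_sum, Finset.sum_ite_eq',
      if_pos (Finset.mem_range.2 (Nat.pos_of_ne_zero hn))] at this
    exact this
  have hgain : φ * (1 - Real.cos v) < Real.sin v := by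
    have hc := Real.one_sub_sq_div_two_le_cos (x := v)
    have hs := Real.mul_le_sin hv0.le (by linarith)
    have hπ4 : π / 8 < 2 / π := by
      rw [lt_div_iff₀ hπ]
      nlinarith [Real.pi_lt_four]
    calc φ * (1 - Real.cos v) ≤ n * (v ^ 2 / 2) := by
          apply mul_le_mul hφn (by linarith) _ hn'.le
          linarith [Real.cos_le_one v]
      _ = π / 8 * v := by linear_combination v / 2 * hvn
      _ < 2 / π * v := by gcongr
      _ ≤ Real.sin v := hs
  have hφ' : ∑ k ∈ Finset.range n, |circleSine (gridPoint n k)| = φ :=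
    Finset.sum_congr rfl fun k _ => by rw [gridPoint, circleSine_coe]
  have hcase : φ < ∑ k ∈ Finset.range n, |Real.sin (u k - v)| ∨
      φ < ∑ k ∈ Finset.range n, |Real.sin (u k + v)| := by
    by_contra! hcon
    nlinarith [hcon.1, hcon.2]
  rw [hφ']
  rcases hcase with hlt | hlt
  · refine ⟨(((1 : ℤ) / (8 * n) : ℝ) : UnitAddCircle), fun k => hne 1 k (Or.inl rfl),
      hlt.trans_eq (Finset.sum_congr rfl fun k _ => ?_)⟩
    rw [hshift]
    congr 2
    simp only [hu, hv]
    push_cast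
    field_simp
    ring
  · refine ⟨(((-1 : ℤ) / (8 * n) : ℝ) : UnitAddCircle), fun k => hne (-1) k (Or.inr rfl),
      hlt.trans_eq (Finset.sum_congr rfl fun k _ => ?_)⟩
    rw [hshift]
    congr 2
    simp only [hu, hv]
    push_cast
    field_simp
    ring

/-! ### Discrete complex measures -/

lemma integrable_fourier_dirac (j : ℤ) (x : UnitAddCircle) (v : ℂ) :
    (VectorMeasure.dirac x v).Integrable (fun ω => (fourier j ω : ℂ)) :=
  (fourier j).continuous.integrable_of_hasCompactSupport (HasCompactSupport.of_compactSpace _)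

lemma trigMoments_sum_dirac {ι : Type*} (m : ℕ) (s : Finset ι) (p : ι → UnitAddCircle) (w : ι → ℂ)
    (j : Finset.Icc (-(m : ℤ)) (m : ℤ)) :
    trigMoments m (∑ i ∈ s, VectorMeasure.dirac (p i) (w i)) j =
      ∑ i ∈ s, (fourier (j : ℤ) (p i) : ℂ) * w i := by
  rw [trigMoments, VectorMeasure.integral_finsetSum_vectorMeasure
    fun i _ => integrable_fourier_dirac _ _ _]
  exact Finset.sum_congr rfl fun i _ => by simp

lemma totalMass_sum_dirac_le {ι : Type*} (s : Finset ι) (p : ι → UnitAddCircle) (w : ι → ℂ) :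
    totalMass (∑ i ∈ s, VectorMeasure.dirac (p i) (w i)) ≤ ∑ i ∈ s, ‖w i‖ₑ := by
  refine (VectorMeasure.variation_finsetSum_le s _ Set.univ).trans_eq ?_
  simp

lemma sum_enorm_le_totalMass_discreteMeasure (X : Finset UnitAddCircle) (c : UnitAddCircle → ℂ) :
    ∑ x ∈ X, ‖c x‖ₑ ≤ totalMass (discreteMeasure X c) := by
  classical
  have hval : ∀ x ∈ X, discreteMeasure X c {x} = c x := by
    intro x hx
    rw [discreteMeasure, FunLike.coe_sum, Finset.sum_apply, Finset.sum_eq_single_of_mem x hx]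
    · simp
    · intro y _ hyx
      exact VectorMeasure.dirac_apply_of_notMem (by simpa using hyx)
  -- The atoms are disjoint measurable sets.
  have := VectorMeasure.le_variation (discreteMeasure X c) MeasurableSet.univ
    (P := X.image fun x => {x}) (fun _ _ => Set.subset_univ _) (by
      rw [Finset.coe_image]
      rintro _ ⟨x, -, rfl⟩ _ ⟨y, -, rfl⟩ hxy
      exact Set.disjoint_singleton.2 fun h => hxy (by rw [h]))
  rw [Finset.sum_image (by intro x _ y _ h; simpa using h)] at this
  exact (Finset.sum_congr rfl fun x hx => by rw [hval x hx]).trans_le this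

/-! ### The counterexample -/

theorem theorem1 (δ : ℝ) (hδ : 2 < δ) :
    ∃ M : ℕ, ∀ m : ℕ, M ≤ m →
      ∃ (X : Finset UnitAddCircle) (c : UnitAddCircle → ℂ),
        ENNReal.ofReal (1 / (m : ℝ) - δ / (m : ℝ) ^ 2) ≤ wrapSep (X : Set UnitAddCircle) ∧
        (∀ x ∈ X, c x ≠ 0) ∧
        ¬ IsTVSolution m (trigMoments m (discreteMeasure X c)) (discreteMeasure X c) := by
  classical
  refine ⟨1, fun m hm => ?_⟩
  have hn : m + 2 ≠ 0 := by omega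
  obtain ⟨h, hne, hlt⟩ := exists_shift_mass_lt hn
  have hinj := gridPoint_injOn hn
  set c : UnitAddCircle → ℂ := fun x => (circleSine (x - h) : ℂ) with hc
  have hμ : discreteMeasure ((Finset.range (m + 2)).image (gridPoint (m + 2))) c =
      ∑ k ∈ Finset.range (m + 2), VectorMeasure.dirac (gridPoint (m + 2) k)
        (circleSine (gridPoint (m + 2) k - h) : ℂ) :=
    Finset.sum_image hinj
  refine ⟨(Finset.range (m + 2)).image (gridPoint (m + 2)), c, ?_, ?_, ?_⟩
  · refine Set.le_einfsep fun x hx y hy hxy => ?_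
    simp only [Finset.coe_image, Set.mem_image] at hx hy
    obtain ⟨k, -, rfl⟩ := hx
    obtain ⟨l, -, rfl⟩ := hy
    rw [edist_dist]
    refine ENNReal.ofReal_le_ofReal (le_trans ?_ (inv_le_dist_gridPoint hn hxy))
    have hm0 : (0 : ℝ) < m := by exact_mod_cast hm
    have h1 : 1 / (m : ℝ) - 2 / (m : ℝ) ^ 2 ≤ 1 / ((m + 2 : ℕ) : ℝ) := by
      push_cast
      rw [div_sub_div _ _ hm0.ne' (by positivity), div_le_div_iff₀ (by positivity) (by positivity)]
      nlinarith
    have h2 : 2 / (m : ℝ) ^ 2 ≤ δ / (m : ℝ) ^ 2 := by gcongr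
    linarith
  · intro x hx
    obtain ⟨k, -, rfl⟩ := Finset.mem_image.1 hx
    exact Complex.ofReal_ne_zero.2 (hne k)
  · rintro ⟨-, hmin⟩
    have hle := hmin (∑ k ∈ Finset.range (m + 2), VectorMeasure.dirac (gridPoint (m + 2) k + h)
        (circleSine (gridPoint (m + 2) k) : ℂ)) (by
      funext j
      rw [hμ, trigMoments_sum_dirac, trigMoments_sum_dirac]
      have hj := Finset.mem_Icc.1 j.2
      refine (grid_sum_sine_mul_fourier ?_ h).symm
      have := abs_le.2 hj
      push_cast
      linarith)
    have hchain := (sum_enorm_le_totalMass_discreteMeasure _ c).trans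
      (hle.trans (totalMass_sum_dirac_le _ _ _))
    rw [Finset.sum_image hinj] at hchain
    have hen : ∀ r : ℝ, ‖(r : ℂ)‖ₑ = ENNReal.ofReal |r| := by
      intro r
      rw [← ofReal_norm, Complex.norm_real, Real.norm_eq_abs]
    simp only [hc, hen] at hchain
    rw [← ENNReal.ofReal_sum_of_nonneg fun _ _ => abs_nonneg _,
      ← ENNReal.ofReal_sum_of_nonneg fun _ _ => abs_nonneg _,
      ENNReal.ofReal_le_ofReal_iff (Finset.sum_nonneg fun _ _ => abs_nonneg _)] at hchain
    exact hchain.not_gt hlt
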